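/- **Setting.** Let $\mathcal T=\{1,\dots,T\}$ be time slots of length $\Delta t=1$ hour, $\mathcal I$ a finite set of charging stations, and $(\mathcal N,\mathcal E)$ a radial distribution network whose lines $(n,j)\in\mathcal E$ are directed away from the slack bus $1$. The stations are connected to different buses $n_i\neq 1$. *Station $i$* chooses $x_i=(p_{d,i},p_{g,i},p^d_{b,i},p^c_{b,i},soc_i)$ subject to, for all $t$, $\check p_{d,i}(t)\le p_{d,i}(t)\le \hat p_{d,i}(t)$; $0\le p^d_{b,i}(t)\le p^{d,\max}_{b,i}$; $0\le p^c_{b,i}(t)\le p^{c,\max}_{b,i}$; $soc_i(t+1)=soc_i(t)-\frac{p^d_{b,i}(t)\Delta t}{\eta_{d}E_i}+\frac{p^c_{b,i}(t)\Delta t\,\eta_{c}}{E_i}$ for $t\ne T$ (with $E_i$ and the efficiencies positive); $soc_i^{\min}\le soc_i(t)\le soc_i^{\max}$; $soc_i(1)=soc_i(T)$; $p_{g,i}^{\min}\le p_{g,i}(t)\le p_{g,i}^{\max}$; $p_{d,i}(t)=p_{g,i}(t)+p_{pv,i}(t)+p^d_{b,i}(t)-p^c_{b,i}(t)$. Its own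 cost is $F_i(x_i)=c_{b,i}\sum_t(p^d_{b,i}(t)+p^c_{b,i}(t))\Delta t+\sum_t c_{cs,i}(\hat p_{d,i}(t)-p_{d,i}(t))$. *The operator (DSO)* chooses $x_d=(p,q,P,Q,\ell,v,p_1^b,p_1^s)$ subject to the branch flow model relaxed to a second-order cone: for $(n,j)\in\mathcal E$ and all $t$, $p_j=P_{nj}-r_{nj}\ell_{nj}-\sum_{k:(j,k)\in\mathcal E}P_{jk}$, $q_j=Q_{nj}-x_{nj}\ell_{nj}-\sum_{k:(j,k)\in\mathcal E}Q_{jk}$, $v_j=v_n-2(r_{nj}P_{nj}+x_{nj}Q_{nj})+(r_{nj}^2+x_{nj}^2)\ell_{nj}$, $\ell_{nj}\ge (P_{nj}^2+Q_{nj}^2)/v_n$; at the slack bus $p_1=-\sum_k P_{1k}$, $q_1=-\sum_kQ_{1k}$, $p_1^b-p_1^s=-p_1$, $p_1^b,p_1^s\ge0$; and bounds $\underline{p_j}\le p_j\le\overline{p_j}$, $\underline{q_j}\le q_j\le\overline{q_j}$, $0\le\ell_{nj}\le\overline{\ell_{nj}}$, $\underline{v_j}\le v_j\le\overline{v_j}$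 with $\underline{v_j}>0$. Its own cost is $G(x_d)=\sum_t\big(p_1^b(t)\lambda^b_g(t)-p_1^s(t)\lambda^s_g(t)\big)+\sum_t\sum_{(n,j)\in\mathcal E}r_{nj}\ell_{nj}(t)\pi(t)$, where $\lambda_g^s(t)<\lambda_g^b(t)$. *The centralized problem* is to minimize $\sum_iF_i(x_i)+G(x_d)$ over all these constraints and the coupling $p_{n_i}(t)=p_{g,i}(t)$. A *dual variable* of the coupling is a $\lambda=(\lambda_{p,i}(t))$ such that the centralized optimal value is attained and is at most $\sum_iF_i(x_i)+G(x_d)+\sum_{i,t}\lambda_{p,i}(t)(p_{g,i}(t)-p_{n_i}(t))\Delta t$ for all $x_i$, $x_d$ that satisfy the station and the DSO constraints but not necessarily the coupling. **Mechanism.** Fix $\rho>0$ and start from $\lambda^0_{p,i}=0$, $p^0_{n_i}=0$. In iteration $k+1$, every station $i$ takes as $x_i^{k+1}$ a minimizer of $F_i(x_i)+\sum_t p_{g,i}(t)\lambda^k_{p,i}(t)\Delta t+\sum_t\frac\rho2(p_{g,i}(t)-p^k_{n_i}(t))^2$ over its constraints; then the DSO takes as $x_d^{k+1}$ a minimizer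 of $G(x_d)-\sum_{i,t}p_{n_i}(t)\lambda^k_{p,i}(t)\Delta t+\sum_{i,t}\frac\rho2(p^{k+1}_{g,i}(t)-p_{n_i}(t))^2$ over its constraints; and $\lambda^{k+1}_{p,i}(t)=\lambda^k_{p,i}(t)+\rho(p^{k+1}_{g,i}(t)-p^{k+1}_{n_i}(t))$. The mechanism stops when $\|\lambda^{k+1}_p-\lambda^k_p\|\le\delta$. **Proposition 2.** Suppose that the centralized problem is feasible and that its coupling constraint has a dual variable. Then the mechanism can be carried out (all the minimizers exist), and, for every choice of the minimizers, it converges to the centralized optimum: there are an optimal solution of the centralized problem, with trading profile $p^*_{g,i}$, and a dual variable $\lambda^*$ of the coupling such that $p^k_{g,i}(t)\to p^*_{g,i}(t)$, $p^k_{n_i}(t)\to p^*_{g,i}(t)$ and $\lambda^k_{p,i}(t)\to\lambda^*_{p,i}(t)$ for all $i,t$; the total cost $\sum_iF_i(x^k_i)+G(x^k_d)$ converges to the centralized optimal value; the complete iterates $((x^k_i)_i,x_d^k)$ converge to the set of optimal solutions of the centralized problem; and for every tolerance $\delta>0$ the stopping criterion is met after finitely many iterations. -/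

import Mathlib

open Filter Topology

namespace ChargingCoordination

/-- The decision variables of one charging station in one time slot: dispatched EV charging power
`p_d`, net imported power `p_g`, battery discharging power `p_b^d`, battery charging power `p_b^c`,
and battery state of charge `soc_b`. -/
inductive CSOVar
  | pd | pg | pbd | pbc | soc
  deriving DecidableEq

/-- The decision variables of the distribution system operator in one time slot: at every bus the
net active and reactive power withdrawals `p`, `q` and the squared voltage magnitude `v`; on every
line the active and reactive flows `P`, `Q` and the squared current magnitude `ell`; and the powers
`pb`, `ps` that the slack bus buys from and sells to the utility grid. -/
inductive DSOVar (B : Type*) (L : Type*)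
  | p (n : B) | q (n : B) | v (n : B)
  | P (e : L) | Q (e : L) | ell (e : L)
  | pb | ps
  deriving DecidableEq

/-- The parameters of a charging station over the time slots `Fin T`. -/
structure Station (T : ℕ) where
  /-- lower boundary of the aggregate EV flexibility region -/
  pdMin : Fin T → ℝ
  /-- upper boundary of the aggregate EV flexibility region -/
  pdMax : Fin T → ℝ
  /-- coefficient of the EV dissatisfaction cost -/
  cEV : ℝ
  pbdMax : ℝ
  pbcMax : ℝ
  /-- discharging efficiency -/
  etaD : ℝ
  /-- charging efficiency -/
  etaC : ℝ
  /-- battery capacity -/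
  cap : ℝ
  socMin : ℝ
  socMax : ℝ
  /-- coefficient of the battery degradation cost -/
  cBat : ℝ
  pgMin : ℝ
  pgMax : ℝ
  /-- photovoltaic generation -/
  ppv : Fin T → ℝ

/-- Charging stations `I` on a distribution network with bus set `B`, over `T` time slots.
A line `(n, j) ∈ lines` is directed away from the slack bus `root`. -/
structure System (I B : Type*) (T : ℕ) where
  /-- length of a time slot, in hours -/
  dt : ℝ
  station : I → Station T
  /-- the bus a charging station is connected to -/
  bus : I → B
  /-- the slack bus (Bus 1) -/
  root : B
  lines : Finset (B × B)
  /-- line resistance -/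
  r : lines → ℝ
  /-- line reactance -/
  x : lines → ℝ
  pMin : B → ℝ
  pMax : B → ℝ
  qMin : B → ℝ
  qMax : B → ℝ
  vMin : B → ℝ
  vMax : B → ℝ
  ellMax : lines → ℝ
  /-- utility price for buying -/
  priceBuy : Fin T → ℝ
  /-- utility price for selling -/
  priceSell : Fin T → ℝ
  /-- monetary value of power losses -/
  lossPrice : Fin T → ℝ

/-- A decision vector of a charging station. -/
abbrev CSODecision (T : ℕ) : Type := CSOVar → Fin T → ℝ

namespace System

variable {I B : Type*} {T : ℕ}

/-- A decision vector of the distribution system operator. -/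
abbrev DSODecision (S : System I B T) : Type _ := DSOVar B S.lines → Fin T → ℝ

/-- The network is radial: its lines form a tree directed away from the slack bus. -/
def Radial (S : System I B T) : Prop :=
  (∀ n, (n, S.root) ∉ S.lines) ∧
  (∀ j, j ≠ S.root → ∃! n, (n, j) ∈ S.lines) ∧
  (∀ j, Relation.ReflTransGen (fun n j => (n, j) ∈ S.lines) S.root j)

/-- Standing conditions on the parameters: time slots of one hour, positive battery capacities and
efficiencies, a radial network, stations at different buses other than the slack bus, positive
lower voltage limits, and a utility selling price below the buying price. -/
structure WellFormed (S : System I B T) : Prop where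
  dt_eq : S.dt = 1
  cap_pos : ∀ i, 0 < (S.station i).cap
  etaD_pos : ∀ i, 0 < (S.station i).etaD
  etaC_pos : ∀ i, 0 < (S.station i).etaC
  radial : S.Radial
  bus_injective : Function.Injective S.bus
  bus_ne_root : ∀ i, S.bus i ≠ S.root
  vMin_pos : ∀ n, 0 < S.vMin n
  price_lt : ∀ t, S.priceSell t < S.priceBuy t

/-! ### The charging stations -/

/-- The constraints of charging station `i`. -/
structure CSOFeasible (S : System I B T) (i : I) (x : CSODecision T) : Prop where
  ev : ∀ t, (S.station i).pdMin t ≤ x .pd t ∧ x .pd t ≤ (S.station i).pdMax t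
  discharge : ∀ t, 0 ≤ x .pbd t ∧ x .pbd t ≤ (S.station i).pbdMax
  charge : ∀ t, 0 ≤ x .pbc t ∧ x .pbc t ≤ (S.station i).pbcMax
  soc_step : ∀ t t' : Fin T, t'.val = t.val + 1 →
    x .soc t' = x .soc t - x .pbd t * S.dt / ((S.station i).etaD * (S.station i).cap)
      + x .pbc t * S.dt * (S.station i).etaC / (S.station i).cap
  soc_range : ∀ t, (S.station i).socMin ≤ x .soc t ∧ x .soc t ≤ (S.station i).socMax
  /-- equal state of charge in the first and the last time slot -/
  soc_cycle : ∀ t t' : Fin T, t.val = 0 → t'.val + 1 = T → x .soc t = x .soc t'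
  trade : ∀ t, (S.station i).pgMin ≤ x .pg t ∧ x .pg t ≤ (S.station i).pgMax
  balance : ∀ t, x .pd t = x .pg t + (S.station i).ppv t + x .pbd t - x .pbc t

/-- Battery degradation cost. -/
def batteryCost (S : System I B T) (i : I) (x : CSODecision T) : ℝ :=
  (S.station i).cBat * ∑ t, (x .pbd t + x .pbc t) * S.dt

/-- EV dissatisfaction cost. -/
def evCost (S : System I B T) (i : I) (x : CSODecision T) : ℝ :=
  ∑ t, (S.station i).cEV * ((S.station i).pdMax t - x .pd t)

/-- Payment for the traded power profile `y` at the energy trading price `lam`. -/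
def tradeCost (S : System I B T) (lam y : Fin T → ℝ) : ℝ :=
  ∑ t, y t * lam t * S.dt

/-- Total operation cost of charging station `i` at the energy trading price `lam`. -/
def csoCost (S : System I B T) (i : I) (lam : Fin T → ℝ) (x : CSODecision T) : ℝ :=
  S.batteryCost i x + S.evCost i x + S.tradeCost lam (x .pg)

/-- Modified objective of charging station `i`, given the announced price `lam` and the desired
trading schedule `pn`. -/
noncomputable def csoObjective (S : System I B T) (rho : ℝ) (i : I) (lam pn : Fin T → ℝ)
    (x : CSODecision T) : ℝ :=
  S.csoCost i lam x + ∑ t, rho / 2 * (x .pg t - pn t) ^ 2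

/-! ### The distribution system operator -/

section DSO

variable [DecidableEq B]

/-- The constraints of the distribution system operator: the branch flow model, with the quadratic
equality for the squared current relaxed to a second-order conic inequality. No line enters the
slack bus, whose net withdrawal is minus the net purchase from the utility grid. -/
structure DSOFeasible (S : System I B T) (d : S.DSODecision) : Prop where
  active : ∀ (e : S.lines) t, d (.p e.1.2) t = d (.P e) t - S.r e * d (.ell e) t
      - ∑ f : S.lines with f.1.1 = e.1.2, d (.P f) t
  reactive : ∀ (e : S.lines) t, d (.q e.1.2) t = d (.Q e) t - S.x e * d (.ell e) t
      - ∑ f : S.lines with f.1.1 = e.1.2, d (.Q f) t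
  active_root : ∀ t, d (.p S.root) t = - ∑ f : S.lines with f.1.1 = S.root, d (.P f) t
  reactive_root : ∀ t, d (.q S.root) t = - ∑ f : S.lines with f.1.1 = S.root, d (.Q f) t
  voltage : ∀ (e : S.lines) t, d (.v e.1.2) t = d (.v e.1.1) t
      - 2 * (S.r e * d (.P e) t + S.x e * d (.Q e) t) + (S.r e ^ 2 + S.x e ^ 2) * d (.ell e) t
  conic : ∀ (e : S.lines) t,
    (d (.P e) t ^ 2 + d (.Q e) t ^ 2) / d (.v e.1.1) t ≤ d (.ell e) t
  p_range : ∀ n t, S.pMin n ≤ d (.p n) t ∧ d (.p n) t ≤ S.pMax n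
  q_range : ∀ n t, S.qMin n ≤ d (.q n) t ∧ d (.q n) t ≤ S.qMax n
  ell_range : ∀ e t, 0 ≤ d (.ell e) t ∧ d (.ell e) t ≤ S.ellMax e
  v_range : ∀ n t, S.vMin n ≤ d (.v n) t ∧ d (.v n) t ≤ S.vMax n
  utility_nonneg : ∀ t, 0 ≤ d .pb t ∧ 0 ≤ d .ps t
  utility_balance : ∀ t, d .pb t - d .ps t = - d (.p S.root) t

end DSO

/-- Cost of the energy exchanged with the utility grid. -/
def utilityCost (S : System I B T) (d : S.DSODecision) : ℝ :=
  ∑ t, (d .pb t * S.priceBuy t - d .ps t * S.priceSell t)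

/-- Cost of the power losses on the lines. -/
def lossCost (S : System I B T) (d : S.DSODecision) : ℝ :=
  ∑ t, ∑ e, S.r e * d (.ell e) t * S.lossPrice t

variable [Fintype I]

/-- Cost of the distribution system operator at the energy trading prices `lam`. -/
def dsoCost (S : System I B T) (lam : I → Fin T → ℝ) (d : S.DSODecision) : ℝ :=
  S.utilityCost d + S.lossCost d - ∑ i, S.tradeCost (lam i) (d (.p (S.bus i)))

/-- Modified objective of the distribution system operator, given the prices `lam` and the trading
profiles `pg` submitted by the charging stations. -/
noncomputable def dsoObjective (S : System I B T) (rho : ℝ) (lam pg : I → Fin T → ℝ) (d : S.DSODecision) : ℝ :=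
  S.dsoCost lam d + ∑ i, ∑ t, rho / 2 * (pg i t - d (.p (S.bus i)) t) ^ 2

/-! ### The centralized problem -/

/-- The total cost of the system. Payments between the stations and the operator cancel. -/
def totalCost (S : System I B T) (x : I → CSODecision T) (d : S.DSODecision) : ℝ :=
  ∑ i, (S.batteryCost i (x i) + S.evCost i (x i)) + S.utilityCost d + S.lossCost d

/-- When the trading profiles match, the total cost is the sum of the costs of all the stations
and of the operator, whatever the prices are. -/
theorem sum_csoCost_add_dsoCost (S : System I B T) (lam : I → Fin T → ℝ) (x : I → CSODecision T)
    (d : S.DSODecision) (h : ∀ i t, d (.p (S.bus i)) t = x i .pg t) :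
    ∑ i, S.csoCost i (lam i) (x i) + S.dsoCost lam d = S.totalCost x d := by
  have h' : ∀ i, d (.p (S.bus i)) = x i .pg := fun i => funext (h i)
  simp only [csoCost, dsoCost, totalCost, h', Finset.sum_add_distrib]
  ring

variable [DecidableEq B]

/-- The constraints of the centralized problem: those of all the stations, those of the operator,
and the coupling of the trading profiles. -/
structure CentralFeasible (S : System I B T) (x : I → CSODecision T) (d : S.DSODecision) :
    Prop where
  cso : ∀ i, S.CSOFeasible i (x i)
  dso : S.DSOFeasible d
  coupling : ∀ i t, d (.p (S.bus i)) t = x i .pg t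

/-- The optimal solutions of the centralized problem. -/
def CentralOptima (S : System I B T) : Set ((I → CSODecision T) × S.DSODecision) :=
  {z | S.CentralFeasible z.1 z.2 ∧
    ∀ x d, S.CentralFeasible x d → S.totalCost z.1 z.2 ≤ S.totalCost x d}

/-- `lam` is an optimal dual variable (Lagrange multiplier) of the coupling constraint of the
centralized problem. -/
def IsDualVariable (S : System I B T) (lam : I → Fin T → ℝ) : Prop :=
  ∃ z ∈ S.CentralOptima, ∀ x d, (∀ i, S.CSOFeasible i (x i)) → S.DSOFeasible d →
    S.totalCost z.1 z.2 ≤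
      S.totalCost x d + ∑ i, ∑ t, lam i t * (x i .pg t - d (.p (S.bus i)) t) * S.dt

/-! ### The coordination mechanism -/

/-- `x k`, `d k`, `pn k`, `lam k` are the stations' decisions, the operator's decision, the
announced trading schedules and the announced prices after `k` iterations of the mechanism with
penalty parameter `rho`. (There are no decisions at `k = 0`: the values `x 0`, `d 0` are not
used.) -/
structure IsRun (S : System I B T) (rho : ℝ) (x : ℕ → I → CSODecision T) (d : ℕ → S.DSODecision)
    (pn lam : ℕ → I → Fin T → ℝ) : Prop where
  lam_zero : ∀ i t, lam 0 i t = 0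
  pn_zero : ∀ i t, pn 0 i t = 0
  cso_feasible : ∀ k i, S.CSOFeasible i (x (k + 1) i)
  cso_min : ∀ k i, IsMinOn (S.csoObjective rho i (lam k i) (pn k i)) {y | S.CSOFeasible i y}
    (x (k + 1) i)
  dso_feasible : ∀ k, S.DSOFeasible (d (k + 1))
  dso_min : ∀ k, IsMinOn (S.dsoObjective rho (lam k) (fun i => x (k + 1) i .pg))
    {y | S.DSOFeasible y} (d (k + 1))
  pn_succ : ∀ k i t, pn (k + 1) i t = d (k + 1) (.p (S.bus i)) t
  lam_succ : ∀ k i t, lam (k + 1) i t = lam k i t + rho * (x (k + 1) i .pg t - pn (k + 1) i t)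

/-- The Euclidean distance between two price profiles, used by the stopping criterion. -/
noncomputable def priceGap (lam lam' : I → Fin T → ℝ) : ℝ :=
  √(∑ i, ∑ t, (lam' i t - lam i t) ^ 2)

end System

end ChargingCoordination

/-! The mechanism is the alternating direction method of multipliers (ADMM) for minimizing
`stationsCost x + operatorCost d` subject to `stationsTrade x = operatorTrade d`. Both costs are
affine, both feasible sets are convex, and an optimum together with a dual variable is a saddle
point of the Lagrangian (`isSaddlePoint_iff`).

The optimality conditions of the two subproblems, tested at a saddle point and at neighbouring
iterates, show that `‖lam - ls‖² + rho² ‖w - B ys‖²` drops in each iteration by at least the squared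
changes of `lam` and `w` (`lyapunov_succ_le`). Hence these changes vanish, and by compactness every
limit point of the iterates is a saddle point. Centred at such a limit point, the monotone function
tends to zero along an ultrafilter, hence outright: prices and trading profiles converge. The
complete iterates need not converge, as nothing is strictly convex, but all their limit points are
optimal.

The operator's feasible set is unbounded, because purchases and sales can grow together. Since
buying costs strictly more than selling earns, minimizers never do both, and the decisions with this
property form a compact set (`isCompact_dsoNetFeasible`). This yields both the existence of
minimizers and the compactness used above. -/

namespace ChargingCoordination

/-! ### The alternating direction method of multipliers -/

section ADMM

open scoped InnerProductSpace

variable {E D H : Type*} [AddCommGroup E] [Module ℝ E] [AddCommGroup D] [Module ℝ D]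
  [NormedAddCommGroup H] [InnerProductSpace ℝ H]

/-- `(x, y, lam)` is a saddle point of the Lagrangian of the problem of minimizing `f x + g y` over
`x ∈ X`, `y ∈ Y` subject to `A x = B y`. -/
structure IsSaddlePoint (X : Set E) (Y : Set D) (f : E → ℝ) (g : D → ℝ) (A : E →ₗ[ℝ] H)
    (B : D →ₗ[ℝ] H) (x : E) (y : D) (lam : H) : Prop where
  left_mem : x ∈ X
  right_mem : y ∈ Y
  coupling : A x = B y
  le : ∀ x' ∈ X, ∀ y' ∈ Y, f x + g y ≤ f x' + g y' + ⟪lam, A x' - B y'⟫_ℝ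

/-- `x`, `y`, `w`, `lam` are the iterates of the alternating direction method of multipliers with
penalty parameter `rho`, where `w (k + 1) = B (y (k + 1))` and `w 0` is arbitrary. -/
structure IsADMMRun (X : Set E) (Y : Set D) (f : E → ℝ) (g : D → ℝ) (A : E →ₗ[ℝ] H)
    (B : D →ₗ[ℝ] H) (rho : ℝ) (x : ℕ → E) (y : ℕ → D) (w lam : ℕ → H) : Prop where
  left_mem : ∀ k, x (k + 1) ∈ X
  right_mem : ∀ k, y (k + 1) ∈ Y
  left_min : ∀ k, IsMinOn (fun z => f z + ⟪lam k, A z⟫_ℝ + rho / 2 * ‖A z - w k‖ ^ 2) X (x (k + 1))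
  right_min : ∀ k, IsMinOn (fun z => g z - ⟪lam k, B z⟫_ℝ + rho / 2 * ‖A (x (k + 1)) - B z‖ ^ 2) Y
    (y (k + 1))
  w_succ : ∀ k, w (k + 1) = B (y (k + 1))
  lam_succ : ∀ k, lam (k + 1) = lam k + rho • (A (x (k + 1)) - w (k + 1))

/-- Replaces nested subsequences: a single ultrafilter makes decisions and multipliers converge
simultaneously. -/
theorem exists_tendsto_ultrafilter {ι Z : Type*} [TopologicalSpace Z] (U : Ultrafilter ι) {C : Set Z}
    (hC : IsCompact C) (z : ι → Z) (hz : ∀ k, z k ∈ C) : ∃ a ∈ C, Tendsto z U (𝓝 a) :=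
  hC.ultrafilter_le_nhds (U.map z) (le_principal_iff.2 (Filter.mem_map.2 (Filter.univ_mem' hz)))

/-- Divide by `s` and let `s` tend to zero. If `a < 0`, the step size chosen below already gives `s
* |b| ≤ -a / 2`, a contradiction. -/
theorem nonneg_of_forall_mul_add_sq_nonneg {a b : ℝ}
    (h : ∀ s, 0 < s → s ≤ 1 → 0 ≤ s * a + s ^ 2 * b) : 0 ≤ a := by
  by_contra! ha
  have hb : 0 < |b| + 1 := by positivity
  have hs : 0 < min 1 (-a / (2 * (|b| + 1))) := lt_min one_pos (div_pos (by linarith) (by positivity))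
  have h1 := h _ hs (min_le_left _ _)
  set s := min 1 (-a / (2 * (|b| + 1)))
  have h2 : s * (2 * (|b| + 1)) ≤ -a := by
    rw [← le_div_iff₀ (by positivity)]; exact min_le_right _ _
  have h3 : 0 ≤ s * (a + s * b) := by nlinarith
  have h4 : 0 ≤ a + s * b := nonneg_of_mul_nonneg_right h3 hs
  have h5 : s * b ≤ s * |b| := by gcongr; exact le_abs_self b
  nlinarith

/-- First-order optimality condition for a convex function plus a linear and a quadratic term. -/
theorem IsMinOn.variational_inequality {X : Set E} {f : E → ℝ} (hf : ConvexOn ℝ X f)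
    (A : E →ₗ[ℝ] H) {rho : ℝ} {lam w : H} {x : E} (hx : x ∈ X)
    (hmin : IsMinOn (fun z => f z + ⟪lam, A z⟫_ℝ + rho / 2 * ‖A z - w‖ ^ 2) X x)
    {x' : E} (hx' : x' ∈ X) :
    0 ≤ f x' - f x + ⟪lam + rho • (A x - w), A x' - A x⟫_ℝ := by
  -- Compare `x` with the point at fraction `s` of the segment to `x'`: convexity bounds the change
  -- of `f` linearly in `s`, and only the penalty leaves a term in `s ^ 2`.
  refine nonneg_of_forall_mul_add_sq_nonneg (b := rho / 2 * ‖A x' - A x‖ ^ 2) fun s hs0 hs1 => ?_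
  have hmem := hf.1 hx hx' (sub_nonneg.2 hs1) hs0.le (by ring)
  have h1 := hf.2 hx hx' (sub_nonneg.2 hs1) hs0.le (by ring)
  have h2 := isMinOn_iff.1 hmin _ hmem
  have h3 : A ((1 - s) • x + s • x') = A x + s • (A x' - A x) := by
    simp only [map_add, map_smul]; module
  have h4 : ‖A x + s • (A x' - A x) - w‖ ^ 2
      = ‖A x - w‖ ^ 2 + 2 * (s * ⟪A x - w, A x' - A x⟫_ℝ) + s ^ 2 * ‖A x' - A x‖ ^ 2 := by
    rw [show A x + s • (A x' - A x) - w = (A x - w) + s • (A x' - A x) by abel,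
      norm_add_sq_real, inner_smul_right, norm_smul, mul_pow, Real.norm_eq_abs, sq_abs]
  simp only [h3, h4, inner_add_right, inner_smul_right] at h2
  simp only [smul_eq_mul] at h1
  rw [inner_add_left, real_inner_smul_left]
  nlinarith

/-! ### Optimality conditions and descent of the iterates -/

namespace IsADMMRun

variable {X : Set E} {Y : Set D} {f : E → ℝ} {g : D → ℝ} {A : E →ₗ[ℝ] H} {B : D →ₗ[ℝ] H} {rho : ℝ}
  {x : ℕ → E} {y : ℕ → D} {w lam : ℕ → H}

/-- The first-order condition involves the old `w k`; rewriting it with the new multiplier leaves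
the correction `rho • (w (k + 1) - w k)`. -/
theorem left_inequality (h : IsADMMRun X Y f g A B rho x y w lam) (hf : ConvexOn ℝ X f) (k : ℕ)
    {x' : E} (hx' : x' ∈ X) :
    0 ≤ f x' - f (x (k + 1))
      + ⟪lam (k + 1) + rho • (w (k + 1) - w k), A x' - A (x (k + 1))⟫_ℝ := by
  have := IsMinOn.variational_inequality hf A (h.left_mem k) (h.left_min k) hx'
  rwa [h.lam_succ k, show lam k + rho • (A (x (k + 1)) - w (k + 1)) + rho • (w (k + 1) - w k)
    = lam k + rho • (A (x (k + 1)) - w k) by module]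

/-- No correction occurs here: the multiplier update is exactly the gradient of the penalty at `y (k
+ 1)`. -/
theorem right_inequality (h : IsADMMRun X Y f g A B rho x y w lam) (hg : ConvexOn ℝ Y g) (k : ℕ)
    {y' : D} (hy' : y' ∈ Y) :
    0 ≤ g y' - g (y (k + 1)) - ⟪lam (k + 1), B y' - w (k + 1)⟫_ℝ := by
  have hmin : IsMinOn (fun z => g z + ⟪-lam k, B z⟫_ℝ + rho / 2 * ‖B z - A (x (k + 1))‖ ^ 2) Y
      (y (k + 1)) := by
    simpa only [inner_neg_left, ← sub_eq_add_neg, norm_sub_rev (A (x (k + 1)))] using h.right_min k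
  have := IsMinOn.variational_inequality hg B (h.right_mem k) hmin hy'
  rw [h.lam_succ k, h.w_succ k, sub_eq_add_neg (g y' - _), ← inner_neg_left]
  convert this using 4
  module

/-- The Lyapunov function of the method decreases by the squared residuals. -/
theorem lyapunov_succ_le (h : IsADMMRun X Y f g A B rho x y w lam) (hf : ConvexOn ℝ X f)
    (hg : ConvexOn ℝ Y g) (hrho : 0 < rho) {xs : E} {ys : D} {ls : H}
    (hs : IsSaddlePoint X Y f g A B xs ys ls) (k : ℕ) :
    ‖lam (k + 2) - ls‖ ^ 2 + rho ^ 2 * ‖w (k + 2) - B ys‖ ^ 2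
      + (‖lam (k + 2) - lam (k + 1)‖ ^ 2 + rho ^ 2 * ‖w (k + 2) - w (k + 1)‖ ^ 2)
      ≤ ‖lam (k + 1) - ls‖ ^ 2 + rho ^ 2 * ‖w (k + 1) - B ys‖ ^ 2 := by
  have h1 := h.left_inequality hf (k + 1) hs.left_mem
  have h2 := h.right_inequality hg (k + 1) hs.right_mem
  have h3 := h.right_inequality hg (k + 1) (h.right_mem k)
  -- This uses optimality of `y (k + 1)`, so the descent starts at index 1: `w 0` is arbitrary and
  -- comes from no minimization.
  have h4 := h.right_inequality hg k (h.right_mem (k + 1))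
  have h5 := hs.le _ (h.left_mem (k + 1)) _ (h.right_mem (k + 1))
  have h6 := h.lam_succ (k + 1)
  rw [← h.w_succ] at h3 h4 h5
  rw [hs.coupling] at h1
  simp only [add_assoc, Nat.reduceAdd] at h1 h2 h3 h4 h5 h6
  set r := A (x (k + 2)) - w (k + 2) with hr
  set dw := w (k + 2) - w (k + 1) with hdw
  have hA : A (x (k + 2)) = r + w (k + 2) := by rw [hr]; abel
  have hw : w (k + 1) = w (k + 2) - dw := by rw [hdw]; abel
  have hl : lam (k + 1) = lam (k + 2) - rho • r := by rw [h6]; abel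
  set e := w (k + 2) - B ys with he
  have hB : B ys = w (k + 2) - e := by rw [he]; abel
  set m := lam (k + 2) - ls with hm
  have hls : lam (k + 2) = ls + m := by rw [hm]; abel
  rw [hw] at h3
  rw [hA] at h1
  rw [hB] at h1 h2
  rw [hl] at h4
  rw [show lam (k + 1) - ls = m - rho • r by rw [hl, hm]; abel,
    show lam (k + 2) - lam (k + 1) = rho • r by rw [h6]; abel,
    show w (k + 1) - B ys = e - dw by rw [hw, he]; abel]
  rw [norm_sub_sq_real m, norm_sub_sq_real e, norm_smul, mul_pow, Real.norm_eq_abs, sq_abs,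
    inner_smul_right]
  have e1 : w (k + 2) - e - (r + w (k + 2)) = -(e + r) := by abel
  have e2 : w (k + 2) - e - w (k + 2) = -e := by abel
  have e3 : w (k + 2) - dw - w (k + 2) = -dw := by abel
  rw [e1, hls] at h1
  rw [e2, hls] at h2
  rw [e3, hls] at h3
  rw [hls] at h4
  simp only [inner_neg_right, inner_add_left, inner_add_right, inner_sub_left,
    real_inner_smul_left] at h1 h2 h3 h4 h5
  -- In the sum of `h1`, `h2` and the saddle inequality `h5`, all values of `f` and `g` cancel.
  have key1 : ⟪m, r⟫_ℝ + rho * (⟪dw, e⟫_ℝ + ⟪dw, r⟫_ℝ) ≤ 0 := by linarith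
  -- Monotonicity of the subdifferential of `g`: the sum of `h3` and `h4`, the optimality conditions
  -- of two successive `y` tested at each other.
  have key2 : 0 ≤ rho * ⟪r, dw⟫_ℝ := by linarith
  rw [real_inner_comm] at key2
  rw [real_inner_comm dw e]
  nlinarith [mul_nonneg hrho.le key2, mul_nonneg hrho.le (neg_nonneg.2 key1)]

/-- The Lyapunov function converges and the residuals vanish. -/
theorem tendsto_residuals (h : IsADMMRun X Y f g A B rho x y w lam) (hf : ConvexOn ℝ X f)
    (hg : ConvexOn ℝ Y g) (hrho : 0 < rho) {xs : E} {ys : D} {ls : H}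
    (hs : IsSaddlePoint X Y f g A B xs ys ls) :
    (∃ l, Tendsto (fun k => ‖lam (k + 1) - ls‖ ^ 2 + rho ^ 2 * ‖w (k + 1) - B ys‖ ^ 2) atTop (𝓝 l)) ∧
    Tendsto (fun k => A (x (k + 2)) - w (k + 2)) atTop (𝓝 0) ∧
    Tendsto (fun k => w (k + 2) - w (k + 1)) atTop (𝓝 0) := by
  set V : ℕ → ℝ := fun k => ‖lam (k + 1) - ls‖ ^ 2 + rho ^ 2 * ‖w (k + 1) - B ys‖ ^ 2 with hV
  have hdec := h.lyapunov_succ_le hf hg hrho hs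
  have hanti : Antitone V := antitone_nat_of_succ_le fun k => by
    have := hdec k
    have h1 : 0 ≤ ‖lam (k + 2) - lam (k + 1)‖ ^ 2 + rho ^ 2 * ‖w (k + 2) - w (k + 1)‖ ^ 2 := by
      positivity
    simp only [hV]
    linarith
  have hbdd : BddBelow (Set.range V) := ⟨0, by rintro _ ⟨k, rfl⟩; simp only [hV]; positivity⟩
  have hlim := tendsto_atTop_ciInf hanti hbdd
  have hdiff : Tendsto (fun k => V k - V (k + 1)) atTop (𝓝 0) := by
    simpa using hlim.sub (hlim.comp (tendsto_add_atTop_nat 1))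
  have hsqrt : Tendsto (fun k => √(V k - V (k + 1))) atTop (𝓝 0) := by
    simpa using hdiff.sqrt
  refine ⟨⟨_, hlim⟩, ?_, ?_⟩
  · have : Tendsto (fun k => rho⁻¹ * √(V k - V (k + 1))) atTop (𝓝 0) := by
      simpa using hsqrt.const_mul rho⁻¹
    refine squeeze_zero_norm (fun k => ?_) this
    rw [← div_eq_inv_mul, le_div_iff₀ hrho]
    refine Real.le_sqrt_of_sq_le ?_
    have h1 := hdec k
    have h2 : lam (k + 2) - lam (k + 1) = rho • (A (x (k + 2)) - w (k + 2)) := by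
      rw [h.lam_succ (k + 1)]; abel
    rw [h2, norm_smul, mul_pow, Real.norm_eq_abs, sq_abs] at h1
    have h3 : 0 ≤ rho ^ 2 * ‖w (k + 2) - w (k + 1)‖ ^ 2 := by positivity
    simp only [hV]
    linarith
  · have : Tendsto (fun k => rho⁻¹ * √(V k - V (k + 1))) atTop (𝓝 0) := by
      simpa using hsqrt.const_mul rho⁻¹
    refine squeeze_zero_norm (fun k => ?_) this
    rw [← div_eq_inv_mul, le_div_iff₀ hrho]
    refine Real.le_sqrt_of_sq_le ?_
    have h1 := hdec k
    have h3 : 0 ≤ ‖lam (k + 2) - lam (k + 1)‖ ^ 2 := by positivity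
    simp only [hV]
    linarith

/-! ### Limit points and convergence of ADMM -/

section Convergence

variable [TopologicalSpace E] [TopologicalSpace D] [FiniteDimensional ℝ H] {K : Set D}

/-- Along every ultrafilter at infinity the iterates converge to a saddle point. -/
theorem exists_tendsto_isSaddlePoint (h : IsADMMRun X Y f g A B rho x y w lam)
    (hf : ConvexOn ℝ X f) (hg : ConvexOn ℝ Y g) (hrho : 0 < rho) (hfc : Continuous f)
    (hgc : Continuous g) (hA : Continuous A) (hB : Continuous B) (hX : IsCompact X)
    (hK : IsCompact K) (hKY : K ⊆ Y) (hyK : ∀ k, y (k + 1) ∈ K)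
    (hs : ∃ xs ys ls, IsSaddlePoint X Y f g A B xs ys ls) (U : Ultrafilter ℕ) (hU : ↑U ≤ (atTop : Filter ℕ)) :
    ∃ xs ys ls, IsSaddlePoint X Y f g A B xs ys ls ∧ Tendsto (fun k => x (k + 2)) U (𝓝 xs) ∧
      Tendsto (fun k => y (k + 2)) U (𝓝 ys) ∧ Tendsto (fun k => w (k + 2)) U (𝓝 (B ys)) ∧
      Tendsto (fun k => lam (k + 2)) U (𝓝 ls) := by
  obtain ⟨xs, ys, ls, hs⟩ := hs
  obtain ⟨⟨l, hl⟩, hres, hdw⟩ := h.tendsto_residuals hf hg hrho hs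
  obtain ⟨M, hM⟩ := hl.bddAbove_range
  obtain ⟨a, ha, hxa⟩ := exists_tendsto_ultrafilter U hX (fun k => x (k + 2)) fun k => h.left_mem _
  -- `Y` itself need not be compact; it suffices that the iterates stay in `K`.
  obtain ⟨b, hb, hyb⟩ := exists_tendsto_ultrafilter U hK (fun k => y (k + 2)) fun k => hyK _
  -- The convergent Lyapunov function is bounded by `M` and dominates `‖lam - ls‖ ^ 2`.
  obtain ⟨c, -, hlc⟩ := exists_tendsto_ultrafilter U (isCompact_closedBall ls (√M)) (fun k => lam (k + 2)) fun k => by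
    rw [mem_closedBall_iff_norm]
    refine Real.le_sqrt_of_sq_le ?_
    have h1 := hM ⟨k + 1, rfl⟩
    have h2 : 0 ≤ rho ^ 2 * ‖w (k + 2) - B ys‖ ^ 2 := by positivity
    simp only [add_assoc, Nat.reduceAdd] at h1
    linarith
  have hwb : Tendsto (fun k => w (k + 2)) U (𝓝 (B b)) := by
    simp only [h.w_succ]
    exact (hB.tendsto b).comp hyb
  have hAx : Tendsto (fun k => A (x (k + 2))) U (𝓝 (A a)) := (hA.tendsto a).comp hxa
  have hfx := (hfc.tendsto a).comp hxa
  have hgy := (hgc.tendsto b).comp hyb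
  have hcoup : A a = B b :=
    sub_eq_zero.1 (tendsto_nhds_unique (hAx.sub hwb) (hres.mono_left hU))
  refine ⟨a, b, c, ⟨ha, hKY hb, hcoup, fun x' hx' y' hy' => ?_⟩, hxa, hyb, hwb, hlc⟩
  -- Both optimality conditions pass to the limit, where the correction vanishes; their sum is the
  -- saddle inequality.
  have l1 : 0 ≤ f x' - f a + ⟪c + rho • (0 : H), A x' - A a⟫_ℝ :=
    ge_of_tendsto' ((tendsto_const_nhds.sub hfx).add
      ((hlc.add ((hdw.mono_left hU).const_smul rho)).inner (tendsto_const_nhds.sub hAx)))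
      fun k => h.left_inequality hf (k + 1) hx'
  have l2 : 0 ≤ g y' - g b - ⟪c, B y' - B b⟫_ℝ :=
    ge_of_tendsto' ((tendsto_const_nhds.sub hgy).sub (hlc.inner (tendsto_const_nhds.sub hwb)))
      fun k => h.right_inequality hg (k + 1) hy'
  rw [hcoup, smul_zero, add_zero] at l1
  simp only [inner_sub_right] at l1 l2 ⊢
  linarith

/-- Convergence of the alternating direction method of multipliers. -/
theorem exists_tendsto (h : IsADMMRun X Y f g A B rho x y w lam)
    (hf : ConvexOn ℝ X f) (hg : ConvexOn ℝ Y g) (hrho : 0 < rho) (hfc : Continuous f)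
    (hgc : Continuous g) (hA : Continuous A) (hB : Continuous B) (hX : IsCompact X)
    (hK : IsCompact K) (hKY : K ⊆ Y) (hyK : ∀ k, y (k + 1) ∈ K)
    (hs : ∃ xs ys ls, IsSaddlePoint X Y f g A B xs ys ls) :
    ∃ xs ys ls, IsSaddlePoint X Y f g A B xs ys ls ∧
      Tendsto (fun k => A (x k)) atTop (𝓝 (A xs)) ∧ Tendsto w atTop (𝓝 (A xs)) ∧
      Tendsto lam atTop (𝓝 ls) := by
  obtain ⟨xs, ys, ls, hsad, -, -, hw, hl⟩ := h.exists_tendsto_isSaddlePoint hf hg hrho hfc hgc hA hB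
    hX hK hKY hyK hs (Ultrafilter.of atTop) (Ultrafilter.of_le _)
  -- The Lyapunov function is now centred at the limit point itself. Its limit exists along `atTop`
  -- and is zero along the ultrafilter, so it is zero.
  obtain ⟨⟨l, hV⟩, hres, -⟩ := h.tendsto_residuals hf hg hrho hsad
  have hV2 := hV.comp (tendsto_add_atTop_nat 1)
  have h0 : Tendsto (fun k => ‖lam (k + 2) - ls‖ ^ 2 + rho ^ 2 * ‖w (k + 2) - B ys‖ ^ 2)
      (Ultrafilter.of (atTop : Filter ℕ)) (𝓝 0) := by
    simpa using ((hl.sub_const ls).norm.pow 2).add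
      (((hw.sub_const (B ys)).norm.pow 2).const_mul (rho ^ 2))
  obtain rfl : l = 0 := tendsto_nhds_unique (hV2.mono_left (Ultrafilter.of_le _)) h0
  have hsqrt : Tendsto (fun k => √(‖lam (k + 1) - ls‖ ^ 2 + rho ^ 2 * ‖w (k + 1) - B ys‖ ^ 2))
      atTop (𝓝 0) := by simpa using hV.sqrt
  have hl' : Tendsto lam atTop (𝓝 ls) := by
    rw [← tendsto_add_atTop_iff_nat 1, tendsto_iff_norm_sub_tendsto_zero]
    refine squeeze_zero (fun _ => norm_nonneg _) (fun k => Real.le_sqrt_of_sq_le ?_) hsqrt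
    have : 0 ≤ rho ^ 2 * ‖w (k + 1) - B ys‖ ^ 2 := by positivity
    linarith
  have hw' : Tendsto w atTop (𝓝 (A xs)) := by
    rw [hsad.coupling, ← tendsto_add_atTop_iff_nat 1, tendsto_iff_norm_sub_tendsto_zero]
    have h1 : Tendsto (fun k => rho⁻¹ *
        √(‖lam (k + 1) - ls‖ ^ 2 + rho ^ 2 * ‖w (k + 1) - B ys‖ ^ 2)) atTop (𝓝 0) := by
      simpa using hsqrt.const_mul rho⁻¹
    refine squeeze_zero (fun _ => norm_nonneg _) (fun k => ?_) h1
    rw [← div_eq_inv_mul, le_div_iff₀ hrho]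
    refine Real.le_sqrt_of_sq_le ?_
    have : 0 ≤ ‖lam (k + 1) - ls‖ ^ 2 := by positivity
    linarith
  refine ⟨xs, ys, ls, hsad, ?_, hw', hl'⟩
  rw [← tendsto_add_atTop_iff_nat 2]
  simpa using hres.add (hw'.comp (tendsto_add_atTop_nat 2))

end Convergence

end IsADMMRun

end ADMM

/-- Lets closedness of the feasible sets be checked one constraint at a time. -/
theorem le_of_mem_closure {Z : Type*} [TopologicalSpace Z] {s : Set Z} {z : Z} (hz : z ∈ closure s)
    {p q : Z → ℝ} (hp : Continuous p) (hq : Continuous q) (h : ∀ y ∈ s, p y ≤ q y) : p z ≤ q z :=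
  closure_minimal h (isClosed_le hp hq) hz

theorem eq_of_mem_closure {Z : Type*} [TopologicalSpace Z] {s : Set Z} {z : Z} (hz : z ∈ closure s)
    {p q : Z → ℝ} (hp : Continuous p) (hq : Continuous q) (h : ∀ y ∈ s, p y = q y) : p z = q z :=
  closure_minimal h (isClosed_eq hp hq) hz

namespace System

open scoped InnerProductSpace

variable {I B : Type*} {T : ℕ}

/-! ### The feasible set of a charging station -/

theorem convex_csoFeasible (S : System I B T) (i : I) : Convex ℝ {x | S.CSOFeasible i x} := by
  intro x hx y hy a b ha hb hab
  have range : ∀ {l u p q : ℝ}, l ≤ p ∧ p ≤ u → l ≤ q ∧ q ≤ u → l ≤ a * p + b * q ∧ a * p + b * q ≤ u :=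
    fun hp hq => convex_Icc _ _ hp hq ha hb hab
  obtain rfl : b = 1 - a := by linarith
  refine ⟨fun t => range (hx.ev t) (hy.ev t), fun t => range (hx.discharge t) (hy.discharge t),
    fun t => range (hx.charge t) (hy.charge t), fun t t' h => ?_,
    fun t => range (hx.soc_range t) (hy.soc_range t), fun t t' h h' => ?_,
    fun t => range (hx.trade t) (hy.trade t), fun t => ?_⟩ <;>
  simp only [Pi.add_apply, Pi.smul_apply, smul_eq_mul]
  · rw [hx.soc_step t t' h, hy.soc_step t t' h]; ring
  · rw [hx.soc_cycle t t' h h', hy.soc_cycle t t' h h']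
  · rw [hx.balance t, hy.balance t]; ring

theorem isClosed_csoFeasible (S : System I B T) (i : I) : IsClosed {x | S.CSOFeasible i x} := by
  refine isClosed_of_closure_subset fun x hx => ⟨fun t => ⟨?_, ?_⟩, fun t => ⟨?_, ?_⟩,
    fun t => ⟨?_, ?_⟩, fun t t' h => ?_, fun t => ⟨?_, ?_⟩, fun t t' h h' => ?_,
    fun t => ⟨?_, ?_⟩, fun t => ?_⟩
  · exact le_of_mem_closure hx (by fun_prop) (by fun_prop) fun y hy => (hy.ev t).1
  · exact le_of_mem_closure hx (by fun_prop) (by fun_prop) fun y hy => (hy.ev t).2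
  · exact le_of_mem_closure hx (by fun_prop) (by fun_prop) fun y hy => (hy.discharge t).1
  · exact le_of_mem_closure hx (by fun_prop) (by fun_prop) fun y hy => (hy.discharge t).2
  · exact le_of_mem_closure hx (by fun_prop) (by fun_prop) fun y hy => (hy.charge t).1
  · exact le_of_mem_closure hx (by fun_prop) (by fun_prop) fun y hy => (hy.charge t).2
  · exact eq_of_mem_closure hx (by fun_prop) (by fun_prop) fun y hy => hy.soc_step t t' h
  · exact le_of_mem_closure hx (by fun_prop) (by fun_prop) fun y hy => (hy.soc_range t).1
  · exact le_of_mem_closure hx (by fun_prop) (by fun_prop) fun y hy => (hy.soc_range t).2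
  · exact eq_of_mem_closure hx (by fun_prop) (by fun_prop) fun y hy => hy.soc_cycle t t' h h'
  · exact le_of_mem_closure hx (by fun_prop) (by fun_prop) fun y hy => (hy.trade t).1
  · exact le_of_mem_closure hx (by fun_prop) (by fun_prop) fun y hy => (hy.trade t).2
  · exact eq_of_mem_closure hx (by fun_prop) (by fun_prop) fun y hy => hy.balance t

theorem isCompact_csoFeasible (S : System I B T) (i : I) : IsCompact {x | S.CSOFeasible i x} := by
  let lo : CSODecision T
    | .pd => (S.station i).pdMin
    | .pg => fun _ => (S.station i).pgMin
    | .pbd => fun _ => 0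
    | .pbc => fun _ => 0
    | .soc => fun _ => (S.station i).socMin
  let hi : CSODecision T
    | .pd => (S.station i).pdMax
    | .pg => fun _ => (S.station i).pgMax
    | .pbd => fun _ => (S.station i).pbdMax
    | .pbc => fun _ => (S.station i).pbcMax
    | .soc => fun _ => (S.station i).socMax
  refine (isCompact_Icc (a := lo) (b := hi)).of_isClosed_subset (S.isClosed_csoFeasible i)
    fun x hx => ⟨fun v t => ?_, fun v t => ?_⟩ <;> cases v
  exacts [(hx.ev t).1, (hx.trade t).1, (hx.discharge t).1, (hx.charge t).1, (hx.soc_range t).1,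
    (hx.ev t).2, (hx.trade t).2, (hx.discharge t).2, (hx.charge t).2, (hx.soc_range t).2]

/-! ### The feasible set of the operator -/

section DSO

variable [DecidableEq B]

/-- The polynomial form is continuous everywhere and suits convex combinations. -/
theorem conic_iff {P Q v l : ℝ} (hv : 0 < v) : (P ^ 2 + Q ^ 2) / v ≤ l ↔ P ^ 2 + Q ^ 2 ≤ l * v :=
  div_le_iff₀ hv

/-- The rotated second-order cone is convex. -/
theorem conic_convex {P Q v l P' Q' v' l' a b : ℝ} (hv : 0 < v) (hv' : 0 < v')
    (h : P ^ 2 + Q ^ 2 ≤ l * v) (h' : P' ^ 2 + Q' ^ 2 ≤ l' * v') (ha : 0 ≤ a) (hb : 0 ≤ b) :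
    (a * P + b * P') ^ 2 + (a * Q + b * Q') ^ 2 ≤ (a * l + b * l') * (a * v + b * v') := by
  -- The cross term of the expanded square. After multiplication by `v * v'` it follows from the two
  -- cone inequalities and from `(v * P' - v' * P) ^ 2 ≥ 0`, likewise for `Q`.
  have key : 2 * (P * P' + Q * Q') ≤ v * l' + v' * l := by
    have h1 : 0 ≤ (v * v') * (v * l' + v' * l - 2 * (P * P' + Q * Q')) := by
      nlinarith [mul_le_mul_of_nonneg_left h (sq_nonneg v'),
        mul_le_mul_of_nonneg_left h' (sq_nonneg v), sq_nonneg (v * P' - v' * P),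
        sq_nonneg (v * Q' - v' * Q)]
    linarith [nonneg_of_mul_nonneg_right h1 (mul_pos hv hv')]
  nlinarith [mul_le_mul_of_nonneg_left h (sq_nonneg a), mul_le_mul_of_nonneg_left h' (sq_nonneg b),
    mul_le_mul_of_nonneg_left key (mul_nonneg ha hb)]

theorem convex_dsoFeasible (S : System I B T) (hS : S.WellFormed) :
    Convex ℝ {d | S.DSOFeasible d} := by
  intro x hx y hy a b ha hb hab
  have range : ∀ {l u p q : ℝ}, l ≤ p ∧ p ≤ u → l ≤ q ∧ q ≤ u → l ≤ a * p + b * q ∧ a * p + b * q ≤ u :=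
    fun hp hq => convex_Icc _ _ hp hq ha hb hab
  have hv : ∀ n t, 0 < x (.v n) t := fun n t => (hS.vMin_pos n).trans_le (hx.v_range n t).1
  have hv' : ∀ n t, 0 < y (.v n) t := fun n t => (hS.vMin_pos n).trans_le (hy.v_range n t).1
  refine ⟨fun e t => ?_, fun e t => ?_, fun t => ?_, fun t => ?_, fun e t => ?_, fun e t => ?_,
    fun n t => range (hx.p_range n t) (hy.p_range n t),
    fun n t => range (hx.q_range n t) (hy.q_range n t),
    fun e t => range (hx.ell_range e t) (hy.ell_range e t),
    fun n t => range (hx.v_range n t) (hy.v_range n t), fun t => ?_, fun t => ?_⟩ <;>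
  simp only [Pi.add_apply, Pi.smul_apply, smul_eq_mul, Finset.sum_add_distrib, ← Finset.mul_sum]
  · rw [hx.active e t, hy.active e t]; ring
  · rw [hx.reactive e t, hy.reactive e t]; ring
  · rw [hx.active_root t, hy.active_root t]; ring
  · rw [hx.reactive_root t, hy.reactive_root t]; ring
  · rw [hx.voltage e t, hy.voltage e t]; ring
  · have hpos : 0 < a * x (.v e.1.1) t + b * y (.v e.1.1) t :=
      convex_Ioi (0 : ℝ) (hv _ _) (hv' _ _) ha hb hab
    rw [conic_iff hpos]
    exact conic_convex (hv _ _) (hv' _ _) ((conic_iff (hv _ _)).1 (hx.conic e t))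
      ((conic_iff (hv' _ _)).1 (hy.conic e t)) ha hb
  · have h1 := hx.utility_nonneg t
    have h2 := hy.utility_nonneg t
    exact ⟨add_nonneg (mul_nonneg ha h1.1) (mul_nonneg hb h2.1),
      add_nonneg (mul_nonneg ha h1.2) (mul_nonneg hb h2.2)⟩
  · linear_combination a * hx.utility_balance t + b * hy.utility_balance t

theorem isClosed_dsoFeasible (S : System I B T) (hS : S.WellFormed) :
    IsClosed {d | S.DSOFeasible d} := by
  refine isClosed_of_closure_subset fun x hx => ?_
  -- Needed first: the conic constraint can be cleared of its denominator at a closure point only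
  -- once the voltage there is known to be positive.
  have hv : ∀ n t, S.vMin n ≤ x (.v n) t := fun n t =>
    le_of_mem_closure hx (by fun_prop) (by fun_prop) fun y hy => (hy.v_range n t).1
  refine ⟨fun e t => ?_, fun e t => ?_, fun t => ?_, fun t => ?_, fun e t => ?_, fun e t => ?_,
    fun n t => ⟨?_, ?_⟩, fun n t => ⟨?_, ?_⟩, fun e t => ⟨?_, ?_⟩, fun n t => ⟨hv n t, ?_⟩,
    fun t => ⟨?_, ?_⟩, fun t => ?_⟩
  · exact eq_of_mem_closure hx (by fun_prop) (by fun_prop) fun y hy => hy.active e t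
  · exact eq_of_mem_closure hx (by fun_prop) (by fun_prop) fun y hy => hy.reactive e t
  · exact eq_of_mem_closure hx (by fun_prop) (by fun_prop) fun y hy => hy.active_root t
  · exact eq_of_mem_closure hx (by fun_prop) (by fun_prop) fun y hy => hy.reactive_root t
  · exact eq_of_mem_closure hx (by fun_prop) (by fun_prop) fun y hy => hy.voltage e t
  · rw [conic_iff ((hS.vMin_pos _).trans_le (hv _ _))]
    exact le_of_mem_closure hx (by fun_prop) (by fun_prop) fun y hy =>
      (conic_iff ((hS.vMin_pos _).trans_le (hy.v_range _ t).1)).1 (hy.conic e t)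
  · exact le_of_mem_closure hx (by fun_prop) (by fun_prop) fun y hy => (hy.p_range n t).1
  · exact le_of_mem_closure hx (by fun_prop) (by fun_prop) fun y hy => (hy.p_range n t).2
  · exact le_of_mem_closure hx (by fun_prop) (by fun_prop) fun y hy => (hy.q_range n t).1
  · exact le_of_mem_closure hx (by fun_prop) (by fun_prop) fun y hy => (hy.q_range n t).2
  · exact le_of_mem_closure hx (by fun_prop) (by fun_prop) fun y hy => (hy.ell_range e t).1
  · exact le_of_mem_closure hx (by fun_prop) (by fun_prop) fun y hy => (hy.ell_range e t).2
  · exact le_of_mem_closure hx (by fun_prop) (by fun_prop) fun y hy => (hy.v_range n t).2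
  · exact le_of_mem_closure hx (by fun_prop) (by fun_prop) fun y hy => (hy.utility_nonneg t).1
  · exact le_of_mem_closure hx (by fun_prop) (by fun_prop) fun y hy => (hy.utility_nonneg t).2
  · exact eq_of_mem_closure hx (by fun_prop) (by fun_prop) fun y hy => hy.utility_balance t

/-- The feasible decisions of the operator that never buy and sell simultaneously. -/
def DSONetFeasible (S : System I B T) : Set S.DSODecision :=
  {d | S.DSOFeasible d ∧ ∀ t, d .pb t * d .ps t = 0}

/-- The variables without upper bounds are bounded indirectly: flows by the conic constraint with
the limits on `ell` and `v`, and `pb`, `ps` by the balance at the slack bus, since one of them is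
zero. -/
theorem isCompact_dsoNetFeasible (S : System I B T) (hS : S.WellFormed) :
    IsCompact S.DSONetFeasible := by
  have hclosed : IsClosed S.DSONetFeasible := isClosed_of_closure_subset fun d hd =>
    ⟨closure_minimal (fun _ h => h.1) (S.isClosed_dsoFeasible hS) hd, fun t =>
      eq_of_mem_closure hd (by fun_prop) (by fun_prop) fun _ h => h.2 t⟩
  set M : ℝ := max |S.pMin S.root| |S.pMax S.root| with hM
  let F (e : S.lines) : ℝ := √(S.ellMax e * S.vMax e.1.1)
  let lo : S.DSODecision
    | .p n => fun _ => S.pMin n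
    | .q n => fun _ => S.qMin n
    | .v n => fun _ => S.vMin n
    | .P e => fun _ => -F e
    | .Q e => fun _ => -F e
    | .ell _ => fun _ => 0
    | .pb => fun _ => 0
    | .ps => fun _ => 0
  let hi : S.DSODecision
    | .p n => fun _ => S.pMax n
    | .q n => fun _ => S.qMax n
    | .v n => fun _ => S.vMax n
    | .P e => fun _ => F e
    | .Q e => fun _ => F e
    | .ell e => fun _ => S.ellMax e
    | .pb => fun _ => M
    | .ps => fun _ => M
  refine (isCompact_Icc (a := lo) (b := hi)).of_isClosed_subset hclosed fun d ⟨hd, hnet⟩ => ?_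
  have hflow : ∀ e t, d (.P e) t ^ 2 + d (.Q e) t ^ 2 ≤ S.ellMax e * S.vMax e.1.1 := fun e t => by
    have hv := (hS.vMin_pos e.1.1).trans_le (hd.v_range e.1.1 t).1
    refine ((conic_iff hv).1 (hd.conic e t)).trans ?_
    exact mul_le_mul (hd.ell_range e t).2 (hd.v_range _ t).2 hv.le
      ((hd.ell_range e t).1.trans (hd.ell_range e t).2)
  have hP : ∀ e t, |d (.P e) t| ≤ F e := fun e t =>
    Real.abs_le_sqrt (by nlinarith [hflow e t, sq_nonneg (d (.Q e) t)])
  have hQ : ∀ e t, |d (.Q e) t| ≤ F e := fun e t =>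
    Real.abs_le_sqrt (by nlinarith [hflow e t, sq_nonneg (d (.P e) t)])
  have hM1 : -S.pMin S.root ≤ M := (neg_le_abs _).trans (le_max_left _ _)
  have hM2 : S.pMax S.root ≤ M := (le_abs_self _).trans (le_max_right _ _)
  have hM0 : 0 ≤ M := (abs_nonneg _).trans (le_max_left _ _)
  have hpp : ∀ t, d .pb t ≤ M ∧ d .ps t ≤ M := fun t => by
    have h1 := hd.utility_balance t
    have h2 := hd.p_range S.root t
    rcases mul_eq_zero.1 (hnet t) with h | h <;> constructor <;> linarith
  refine ⟨fun v t => ?_, fun v t => ?_⟩ <;> cases v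
  exacts [(hd.p_range _ t).1, (hd.q_range _ t).1, (hd.v_range _ t).1, (abs_le.1 (hP _ t)).1,
    (abs_le.1 (hQ _ t)).1, (hd.ell_range _ t).1, (hd.utility_nonneg t).1, (hd.utility_nonneg t).2,
    (hd.p_range _ t).2, (hd.q_range _ t).2, (hd.v_range _ t).2, (abs_le.1 (hP _ t)).2,
    (abs_le.1 (hQ _ t)).2, (hd.ell_range _ t).2, (hpp t).1, (hpp t).2]

end DSO

/-! ### Netting purchases against sales -/

/-- The operator's decision with simultaneous purchases and sales cancelled. -/
noncomputable def netExchange (S : System I B T) (d : S.DSODecision) : S.DSODecision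
  | .p n => d (.p n)
  | .q n => d (.q n)
  | .v n => d (.v n)
  | .P e => d (.P e)
  | .Q e => d (.Q e)
  | .ell e => d (.ell e)
  | .pb => fun t => d .pb t - min (d .pb t) (d .ps t)
  | .ps => fun t => d .ps t - min (d .pb t) (d .ps t)

theorem netExchange_mem [DecidableEq B] (S : System I B T) {d : S.DSODecision}
    (hd : S.DSOFeasible d) : S.netExchange d ∈ S.DSONetFeasible := by
  refine ⟨⟨hd.active, hd.reactive, hd.active_root, hd.reactive_root, hd.voltage, hd.conic,
    hd.p_range, hd.q_range, hd.ell_range, hd.v_range,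
    fun t => ⟨sub_nonneg.2 (min_le_left _ _), sub_nonneg.2 (min_le_right _ _)⟩, fun t => ?_⟩,
    fun t => ?_⟩
  · have := hd.utility_balance t
    simp only [netExchange]
    linarith
  · simp only [netExchange]
    rcases le_total (d .pb t) (d .ps t) with h | h <;> simp [h]

theorem utilityCost_netExchange (S : System I B T) (d : S.DSODecision) :
    S.utilityCost (S.netExchange d) = S.utilityCost d
      - ∑ t, min (d .pb t) (d .ps t) * (S.priceBuy t - S.priceSell t) := by
  simp only [utilityCost, netExchange, ← Finset.sum_sub_distrib]
  exact Finset.sum_congr rfl fun t _ => by ring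

theorem utilityCost_netExchange_le [DecidableEq B] (S : System I B T) (hS : S.WellFormed)
    {d : S.DSODecision} (hd : S.DSOFeasible d) :
    S.utilityCost (S.netExchange d) ≤ S.utilityCost d := by
  rw [utilityCost_netExchange, sub_le_self_iff]
  exact Finset.sum_nonneg fun t _ => mul_nonneg
    (le_min (hd.utility_nonneg t).1 (hd.utility_nonneg t).2) (sub_nonneg.2 (hS.price_lt t).le)

/-- Netting saves `min pb ps` times a strictly positive price gap in each slot, so a zero saving
forces every minimum to be zero. -/
theorem mem_dsoNetFeasible_of_utilityCost_le [DecidableEq B] (S : System I B T) (hS : S.WellFormed)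
    {d : S.DSODecision} (hd : S.DSOFeasible d)
    (h : S.utilityCost d ≤ S.utilityCost (S.netExchange d)) : d ∈ S.DSONetFeasible := by
  rw [utilityCost_netExchange, le_sub_self_iff] at h
  have hnonneg : ∀ t ∈ Finset.univ,
      0 ≤ min (d .pb t) (d .ps t) * (S.priceBuy t - S.priceSell t) := fun t _ => mul_nonneg
    (le_min (hd.utility_nonneg t).1 (hd.utility_nonneg t).2) (sub_nonneg.2 (hS.price_lt t).le)
  have hzero := (Finset.sum_eq_zero_iff_of_nonneg hnonneg).1
    (le_antisymm h (Finset.sum_nonneg hnonneg))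
  refine ⟨hd, fun t => ?_⟩
  have hmin : min (d .pb t) (d .ps t) = 0 :=
    (mul_eq_zero.1 (hzero t (Finset.mem_univ t))).resolve_right (sub_pos.2 (hS.price_lt t)).ne'
  rcases min_choice (d .pb t) (d .ps t) with h' | h' <;> rw [h'] at hmin <;> rw [hmin]
  exacts [zero_mul _, mul_zero _]

/-- Payments, losses and penalty depend only on `p` and `ell`, which netting leaves unchanged. -/
theorem dsoObjective_sub_netExchange [Fintype I] (S : System I B T) (rho : ℝ) (lam pg : I → Fin T → ℝ)
    (d : S.DSODecision) :
    S.dsoObjective rho lam pg d - S.dsoObjective rho lam pg (S.netExchange d)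
      = S.utilityCost d - S.utilityCost (S.netExchange d) := by
  simp only [dsoObjective, dsoCost, lossCost, tradeCost]
  simp only [netExchange]
  ring

/-! ### The total cost as a sum of two convex functions -/

/-- The total cost of the stations without payments. -/
def stationsCost [Fintype I] (S : System I B T) (x : I → CSODecision T) : ℝ :=
  ∑ i, (S.batteryCost i (x i) + S.evCost i (x i))

/-- The total cost of the operator without payments. -/
def operatorCost (S : System I B T) (d : S.DSODecision) : ℝ :=
  S.utilityCost d + S.lossCost d

theorem totalCost_eq [Fintype I] (S : System I B T) (x : I → CSODecision T) (d : S.DSODecision) :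
    S.totalCost x d = S.stationsCost x + S.operatorCost d := by
  simp only [totalCost, stationsCost, operatorCost]; ring

theorem continuous_stationsCost [Fintype I] (S : System I B T) : Continuous S.stationsCost := by
  unfold stationsCost batteryCost evCost
  fun_prop

theorem continuous_operatorCost (S : System I B T) : Continuous S.operatorCost := by
  unfold operatorCost utilityCost lossCost
  fun_prop

theorem convexOn_stationsCost [Fintype I] (S : System I B T) :
    ConvexOn ℝ {x | ∀ i, S.CSOFeasible i (x i)} S.stationsCost := by
  refine ⟨fun x hx y hy a b ha hb hab i => S.convex_csoFeasible i (hx i) (hy i) ha hb hab,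
    fun x _ y _ a b _ _ hab => le_of_eq ?_⟩
  obtain rfl : b = 1 - a := by linarith
  simp only [stationsCost, batteryCost, evCost, Pi.add_apply, Pi.smul_apply, smul_eq_mul,
    Finset.mul_sum, ← Finset.sum_add_distrib]
  refine Finset.sum_congr rfl fun i _ => Finset.sum_congr rfl fun t _ => ?_
  ring

theorem convexOn_operatorCost [DecidableEq B] (S : System I B T) (hS : S.WellFormed) :
    ConvexOn ℝ {d | S.DSOFeasible d} S.operatorCost := by
  refine ⟨S.convex_dsoFeasible hS, fun x _ y _ a b _ _ hab => le_of_eq ?_⟩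
  simp only [operatorCost, utilityCost, lossCost, Pi.add_apply, Pi.smul_apply, smul_eq_mul,
    Finset.mul_sum, mul_add, add_mul, sub_eq_add_neg, Finset.sum_add_distrib, Finset.sum_neg_distrib,
    mul_neg, neg_add, mul_assoc, mul_left_comm a, mul_left_comm b]
  ring

/-! ### Trading profiles as vectors of a Euclidean space -/

/-- A price or trading profile as a vector of a Euclidean space. -/
noncomputable def profile (y : I → Fin T → ℝ) : EuclideanSpace ℝ (I × Fin T) :=
  WithLp.toLp 2 fun p => y p.1 p.2

/-- The trading profile of the stations. -/
noncomputable def stationsTrade : (I → CSODecision T) →ₗ[ℝ] EuclideanSpace ℝ (I × Fin T) where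
  toFun x := profile fun i => x i .pg
  map_add' _ _ := rfl
  map_smul' _ _ := rfl

/-- The trading profile of the operator. -/
noncomputable def operatorTrade (S : System I B T) :
    S.DSODecision →ₗ[ℝ] EuclideanSpace ℝ (I × Fin T) where
  toFun d := profile fun i => d (.p (S.bus i))
  map_add' _ _ := rfl
  map_smul' _ _ := rfl

theorem stationsTrade_apply (x : I → CSODecision T) :
    stationsTrade x = profile fun i => x i .pg := rfl

theorem operatorTrade_apply (S : System I B T) (d : S.DSODecision) :
    S.operatorTrade d = profile fun i => d (.p (S.bus i)) := rfl

theorem inner_profile [Fintype I] (a b : I → Fin T → ℝ) :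
    ⟪profile a, profile b⟫_ℝ = ∑ i, ∑ t, a i t * b i t := by
  simp [profile, PiLp.inner_apply, Fintype.sum_prod_type, mul_comm]

theorem norm_profile_sq [Fintype I] (a : I → Fin T → ℝ) : ‖profile a‖ ^ 2 = ∑ i, ∑ t, a i t ^ 2 := by
  simp [profile, EuclideanSpace.norm_sq_eq, Fintype.sum_prod_type]

theorem profile_sub (a b : I → Fin T → ℝ) :
    profile a - profile b = profile fun i t => a i t - b i t := rfl

theorem profile_injective : Function.Injective (profile (I := I) (T := T)) := fun _ _ h =>
  funext fun i => funext fun t => congrArg (fun v : EuclideanSpace ℝ (I × Fin T) => v (i, t)) h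

theorem profile_surjective : Function.Surjective (profile (I := I) (T := T)) := fun v =>
  ⟨fun i t => v (i, t), rfl⟩

theorem tendsto_of_tendsto_profile {α : Type*} {l : Filter α} {a : α → I → Fin T → ℝ}
    {b : I → Fin T → ℝ} (h : Tendsto (fun k => profile (a k)) l (𝓝 (profile b))) (i : I) (t : Fin T) :
    Tendsto (fun k => a k i t) l (𝓝 (b i t)) :=
  ((EuclideanSpace.proj (𝕜 := ℝ) (i, t)).continuous.tendsto (profile b)).comp h

theorem continuous_profile : Continuous (profile (I := I) (T := T)) :=
  (PiLp.continuous_toLp 2 _).comp (by fun_prop)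

theorem continuous_stationsTrade : Continuous (stationsTrade (I := I) (T := T)) :=
  continuous_profile.comp (by fun_prop : Continuous fun (x : I → CSODecision T) i => x i .pg)

theorem continuous_operatorTrade (S : System I B T) : Continuous S.operatorTrade :=
  continuous_profile.comp (by fun_prop : Continuous fun (d : S.DSODecision) i => d (.p (S.bus i)))

theorem exists_isMinOn_csoObjective (S : System I B T) (rho : ℝ) (i : I) (lam pn : Fin T → ℝ)
    (hne : ∃ x, S.CSOFeasible i x) :
    ∃ x, S.CSOFeasible i x ∧ IsMinOn (S.csoObjective rho i lam pn) {y | S.CSOFeasible i y} x :=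
  (S.isCompact_csoFeasible i).exists_isMinOn hne (by
    unfold csoObjective csoCost batteryCost evCost tradeCost
    fun_prop)

/-! ### Objectives and saddle points in ADMM form -/

variable [Fintype I]

/-- With slots of one hour the payment is a plain inner product, so the announced price is the ADMM
multiplier itself. -/
theorem sum_csoObjective (S : System I B T) (hdt : S.dt = 1) (rho : ℝ) (lam pn : I → Fin T → ℝ)
    (x : I → CSODecision T) :
    ∑ i, S.csoObjective rho i (lam i) (pn i) (x i) = S.stationsCost x
      + ⟪profile lam, stationsTrade x⟫_ℝ + rho / 2 * ‖stationsTrade x - profile pn‖ ^ 2 := by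
  simp only [stationsTrade_apply, profile_sub, norm_profile_sq, inner_profile, csoObjective, csoCost,
    tradeCost, stationsCost, hdt, mul_one, Finset.sum_add_distrib, Finset.mul_sum,
    mul_comm (lam _ _)]

theorem dsoObjective_eq (S : System I B T) (hdt : S.dt = 1) (rho : ℝ) (lam : I → Fin T → ℝ)
    (x : I → CSODecision T) (d : S.DSODecision) :
    S.dsoObjective rho lam (fun i => x i .pg) d = S.operatorCost d
      - ⟪profile lam, S.operatorTrade d⟫_ℝ
      + rho / 2 * ‖stationsTrade x - S.operatorTrade d‖ ^ 2 := by
  simp only [stationsTrade_apply, operatorTrade_apply, profile_sub, norm_profile_sq, inner_profile,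
    dsoObjective, dsoCost, tradeCost, operatorCost, hdt, mul_one, Finset.mul_sum,
    mul_comm (lam _ _)]

variable [DecidableEq B]

/-- On coupled decisions the multiplier term vanishes, so the saddle inequality contains central
optimality. -/
theorem isSaddlePoint_iff (S : System I B T) (hdt : S.dt = 1) (x : I → CSODecision T)
    (d : S.DSODecision) (lam : I → Fin T → ℝ) :
    IsSaddlePoint {x | ∀ i, S.CSOFeasible i (x i)} {d | S.DSOFeasible d} S.stationsCost
      S.operatorCost stationsTrade S.operatorTrade x d (profile lam) ↔
    (x, d) ∈ S.CentralOptima ∧ ∀ x' d', (∀ i, S.CSOFeasible i (x' i)) → S.DSOFeasible d' →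
      S.totalCost x d ≤ S.totalCost x' d'
        + ∑ i, ∑ t, lam i t * (x' i .pg t - d' (.p (S.bus i)) t) * S.dt := by
  have hinner : ∀ x' d', ⟪profile lam, stationsTrade x' - S.operatorTrade d'⟫_ℝ
      = ∑ i, ∑ t, lam i t * (x' i .pg t - d' (.p (S.bus i)) t) * S.dt := fun x' d' => by
    simp only [stationsTrade_apply, operatorTrade_apply, profile_sub, inner_profile, hdt, mul_one]
  constructor
  · intro h
    have hle : ∀ x' d', (∀ i, S.CSOFeasible i (x' i)) → S.DSOFeasible d' →
      S.totalCost x d ≤ S.totalCost x' d'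
        + ∑ i, ∑ t, lam i t * (x' i .pg t - d' (.p (S.bus i)) t) * S.dt := fun x' d' hx' hd' => by
      rw [totalCost_eq, totalCost_eq, ← hinner]
      exact h.le x' hx' d' hd'
    refine ⟨⟨⟨h.left_mem, h.right_mem, fun i t => ?_⟩, fun x' d' h' => ?_⟩, hle⟩
    · exact (congrFun (congrFun (profile_injective (a₁ := fun i => x i .pg)
        (a₂ := fun i => d (.p (S.bus i))) h.coupling) i) t).symm
    · simpa [h'.coupling] using hle x' d' h'.cso h'.dso
  · rintro ⟨⟨hfeas, -⟩, hle⟩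
    refine ⟨hfeas.cso, hfeas.dso, ?_, fun x' hx' d' hd' => ?_⟩
    · exact congrArg profile (funext fun i => funext fun t => (hfeas.coupling i t).symm)
    · rw [hinner, ← totalCost_eq, ← totalCost_eq]
      exact hle x' d' hx' hd'

/-! ### The mechanism as an alternating direction method of multipliers -/

theorem IsRun.isADMMRun {S : System I B T} (hdt : S.dt = 1) {rho : ℝ}
    {x : ℕ → I → CSODecision T} {d : ℕ → S.DSODecision} {pn lam : ℕ → I → Fin T → ℝ}
    (h : S.IsRun rho x d pn lam) :
    IsADMMRun {x | ∀ i, S.CSOFeasible i (x i)} {d | S.DSOFeasible d} S.stationsCost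
      S.operatorCost stationsTrade S.operatorTrade rho x d (fun k => profile (pn k))
      (fun k => profile (lam k)) where
  left_mem := h.cso_feasible
  right_mem := h.dso_feasible
  -- The joint objective is separable, so the stations' individual minimizers minimize the sum.
  left_min k := isMinOn_iff.2 fun y hy => by
    rw [← sum_csoObjective S hdt, ← sum_csoObjective S hdt]
    exact Finset.sum_le_sum fun i _ => isMinOn_iff.1 (h.cso_min k i) _ (hy i)
  right_min k := isMinOn_iff.2 fun y hy => by
    rw [← dsoObjective_eq S hdt, ← dsoObjective_eq S hdt]
    exact isMinOn_iff.1 (h.dso_min k) _ hy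
  w_succ k := congrArg profile (funext fun i => funext fun t => h.pn_succ k i t)
  lam_succ k := congrArg profile (funext fun i => funext fun t => h.lam_succ k i t)

/-- Otherwise netting would strictly improve a minimizer. This confines the operator's iterates to a
compact set. -/
theorem IsRun.mem_dsoNetFeasible {S : System I B T} (hS : S.WellFormed) {rho : ℝ}
    {x : ℕ → I → CSODecision T} {d : ℕ → S.DSODecision} {pn lam : ℕ → I → Fin T → ℝ}
    (h : S.IsRun rho x d pn lam) (k : ℕ) : d (k + 1) ∈ S.DSONetFeasible := by
  refine S.mem_dsoNetFeasible_of_utilityCost_le hS (h.dso_feasible k) ?_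
  have h1 := isMinOn_iff.1 (h.dso_min k) _ (S.netExchange_mem (h.dso_feasible k)).1
  have h2 := S.dsoObjective_sub_netExchange rho (lam k) (fun i => x (k + 1) i .pg) (d (k + 1))
  linarith

/-- A minimizer over the compact net set is global, since netting never raises the objective. -/
theorem exists_isMinOn_dsoObjective (S : System I B T) (hS : S.WellFormed) (rho : ℝ)
    (lam pg : I → Fin T → ℝ) (hne : ∃ d, S.DSOFeasible d) :
    ∃ d, S.DSOFeasible d ∧ IsMinOn (S.dsoObjective rho lam pg) {y | S.DSOFeasible y} d := by
  obtain ⟨d₀, hd₀⟩ := hne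
  obtain ⟨d, hd, hmin⟩ := (S.isCompact_dsoNetFeasible hS).exists_isMinOn ⟨_, S.netExchange_mem hd₀⟩
    (f := S.dsoObjective rho lam pg) (by
      unfold dsoObjective dsoCost utilityCost lossCost tradeCost
      fun_prop)
  refine ⟨d, hd.1, isMinOn_iff.2 fun y hy => ?_⟩
  have h1 := isMinOn_iff.1 hmin _ (S.netExchange_mem hy)
  have h2 := S.dsoObjective_sub_netExchange rho lam pg y
  have h3 := S.utilityCost_netExchange_le hS hy
  linarith

theorem exists_isRun (S : System I B T) (hS : S.WellFormed) (rho : ℝ)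
    (hfeas : ∃ x d, S.CentralFeasible x d) : ∃ x d pn lam, S.IsRun rho x d pn lam := by
  obtain ⟨x₀, d₀, h₀⟩ := hfeas
  choose X hX hXmin using fun (lam pn : I → Fin T → ℝ) (i : I) =>
    S.exists_isMinOn_csoObjective rho i (lam i) (pn i) ⟨_, h₀.cso i⟩
  choose D hD hDmin using fun (lam pg : I → Fin T → ℝ) =>
    S.exists_isMinOn_dsoObjective hS rho lam pg ⟨_, h₀.dso⟩
  let dispatch (lam pn : I → Fin T → ℝ) : S.DSODecision := D lam fun i => X lam pn i .pg
  let next (s : (I → Fin T → ℝ) × (I → Fin T → ℝ)) : (I → Fin T → ℝ) × (I → Fin T → ℝ) :=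
    (fun i => dispatch s.2 s.1 (.p (S.bus i)),
      fun i t => s.2 i t + rho * (X s.2 s.1 i .pg t - dispatch s.2 s.1 (.p (S.bus i)) t))
  -- The state is the pair of schedule `pn` and price `lam`, in this order; `x₀` and `d₀` only fill
  -- the unused index 0.
  let s (k : ℕ) : (I → Fin T → ℝ) × (I → Fin T → ℝ) := next^[k] (0, 0)
  have hs : ∀ k, s (k + 1) = next (s k) := fun k => Function.iterate_succ_apply' next k _
  let x : ℕ → I → CSODecision T := fun k => k.casesOn x₀ fun k => X (s k).2 (s k).1
  let d : ℕ → S.DSODecision := fun k => k.casesOn d₀ fun k => dispatch (s k).2 (s k).1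
  refine ⟨x, d, fun k => (s k).1, fun k => (s k).2, fun _ _ => rfl, fun _ _ => rfl,
    fun k i => hX _ _ i, fun k i => hXmin _ _ i, fun k => hD _ _, fun k => hDmin _ _,
    fun k i t => ?_, fun k i t => ?_⟩
  · simp only [hs]; rfl
  · simp only [hs]; rfl

end System

end ChargingCoordination

/-! ### Convergence of the mechanism -/

open ChargingCoordination System in
theorem proposition2 {I B : Type*} [Fintype I] [Fintype B] [DecidableEq B] {T : ℕ}
    (S : ChargingCoordination.System I B T) (hS : S.WellFormed)
    (hfeas : ∃ x d, S.CentralFeasible x d)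
    (hdual : ∃ lam, S.IsDualVariable lam)
    (rho : ℝ) (hrho : 0 < rho) :
    (∃ x d pn lam, S.IsRun rho x d pn lam) ∧
    ∀ x d pn lam, S.IsRun rho x d pn lam →
      (∃ z ∈ S.CentralOptima, ∃ lamStar, S.IsDualVariable lamStar ∧
        (∀ i t, Tendsto (fun k => x k i .pg t) atTop (𝓝 (z.1 i .pg t))) ∧
        (∀ i t, Tendsto (fun k => pn k i t) atTop (𝓝 (z.1 i .pg t))) ∧
        (∀ i t, Tendsto (fun k => lam k i t) atTop (𝓝 (lamStar i t))) ∧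
        Tendsto (fun k => S.totalCost (x k) (d k)) atTop (𝓝 (S.totalCost z.1 z.2))) ∧
      Tendsto (fun k => (x k, d k)) atTop (𝓝ˢ S.CentralOptima) ∧
      (∀ δ > 0, ∃ k, ChargingCoordination.System.priceGap (lam k) (lam (k + 1)) ≤ δ) := by
  refine ⟨S.exists_isRun hS rho hfeas, fun x d pn lam h => ?_⟩
  have hdt := hS.dt_eq
  have hadmm := h.isADMMRun hdt
  have hsaddle : ∃ xs ds ls, IsSaddlePoint {x | ∀ i, S.CSOFeasible i (x i)} {d | S.DSOFeasible d}
      S.stationsCost S.operatorCost stationsTrade S.operatorTrade xs ds ls := by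
    obtain ⟨l, z, hz, hle⟩ := hdual
    exact ⟨z.1, z.2, profile l, (S.isSaddlePoint_iff hdt _ _ _).2 ⟨hz, hle⟩⟩
  have hX : IsCompact {x : I → CSODecision T | ∀ i, S.CSOFeasible i (x i)} :=
    isCompact_pi_infinite S.isCompact_csoFeasible
  have hK := S.isCompact_dsoNetFeasible hS
  have hKY : S.DSONetFeasible ⊆ {d | S.DSOFeasible d} := fun _ hd => hd.1
  have hlim : Tendsto (fun k => (x k, d k)) atTop (𝓝ˢ S.CentralOptima) := by
    -- It suffices that along each ultrafilter at infinity the iterates tend to some optimum, which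
    -- may vary with the ultrafilter.
    rw [← tendsto_add_atTop_iff_nat 2, tendsto_iff_ultrafilter]
    intro U hU
    obtain ⟨xs, ds, ls, hs, hx, hd, -⟩ := hadmm.exists_tendsto_isSaddlePoint
      S.convexOn_stationsCost (S.convexOn_operatorCost hS) hrho S.continuous_stationsCost
      S.continuous_operatorCost continuous_stationsTrade S.continuous_operatorTrade hX hK hKY
      (h.mem_dsoNetFeasible hS) hsaddle U hU
    obtain ⟨l, rfl⟩ := profile_surjective ls
    exact (hx.prodMk_nhds hd).mono_right (nhds_le_nhdsSet ((S.isSaddlePoint_iff hdt _ _ _).1 hs).1)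
  obtain ⟨xs, ds, ls, hs, hpg, hpn, hlam⟩ := hadmm.exists_tendsto
    S.convexOn_stationsCost (S.convexOn_operatorCost hS) hrho S.continuous_stationsCost
    S.continuous_operatorCost continuous_stationsTrade S.continuous_operatorTrade hX hK hKY
    (h.mem_dsoNetFeasible hS) hsaddle
  obtain ⟨l, rfl⟩ := profile_surjective ls
  obtain ⟨hopt, hle⟩ := (S.isSaddlePoint_iff hdt _ _ _).1 hs
  have hlam' := tendsto_of_tendsto_profile hlam
  refine ⟨⟨(xs, ds), hopt, l, ⟨(xs, ds), hopt, hle⟩, tendsto_of_tendsto_profile hpg,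
    tendsto_of_tendsto_profile hpn, hlam', ?_⟩, hlim, fun δ hδ => ?_⟩
  · have hcont : Continuous fun z : (I → CSODecision T) × S.DSODecision => S.totalCost z.1 z.2 := by
      simp only [totalCost_eq]
      exact (S.continuous_stationsCost.comp continuous_fst).add
        (S.continuous_operatorCost.comp continuous_snd)
    rw [tendsto_def]
    intro V hV
    obtain ⟨W, hWV, hWo, hW⟩ := mem_nhds_iff.1 hV
    -- All optima have the same cost, so the preimage of a neighbourhood of that value is a
    -- neighbourhood of the whole optimal set.
    refine mem_of_superset (hlim ((hWo.preimage hcont).mem_nhdsSet.2 fun z hz => ?_))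
      (Set.preimage_mono hWV)
    rw [Set.mem_preimage, le_antisymm (hz.2 _ _ hopt.1) (hopt.2 _ _ hz.1)]
    exact hW
  · have hgap : Tendsto (fun k => priceGap (lam k) (lam (k + 1))) atTop (𝓝 0) := by
      have : Tendsto (fun k => √(∑ i, ∑ t, (lam (k + 1) i t - lam k i t) ^ 2)) atTop
          (𝓝 √(∑ i, ∑ t, (l i t - l i t) ^ 2)) :=
        (tendsto_finsetSum _ fun i _ => tendsto_finsetSum _ fun t _ =>
          (((hlam' i t).comp (tendsto_add_atTop_nat 1)).sub (hlam' i t)).pow 2).sqrt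
      simpa [priceGap] using this
    obtain ⟨k, hk⟩ := (hgap.eventually (gt_mem_nhds hδ)).exists
    exact ⟨k, hk.le⟩
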